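/- Let $\theta:\mathbb N\to\mathbb N$ be a function. A function $h:R\to[0,\infty)$ on an integral domain $R$ is called a height function of $\theta$-type if for every $m\in\mathbb N$ and all $x,y\in R$ with $h(x)\le m$ and $h(y)\le m$ one has $h(x+y)\le\theta(m)$, $h(xy)\le\theta(m)$ and $h(-x)\le\theta(m)$. For a polynomial $f=\sum_\alpha a_\alpha X^\alpha\in R[X_1,\dots,X_n]$ put $h(f)=\max_\alpha h(a_\alpha)$, and let $\deg f$ be its total degree. Say that $R$ is a UFD with the p-property if $R$ is a unique factorization domain endowed with a real absolute value $|\cdot|$ such that every unit has absolute value $1$ and, whenever there are primes $p,q$ with $|p|<1<|q|$, there is a prime $r$ not associated to $p$ with $|r|<1$. Theorem. For all integers $n\ge1$, $D\ge1$ there is a constant $c_1=c_1(n,D)$, and for all real $H\ge 1$ and all $\theta:\mathbb N\to\mathbb N$ there is a constant $c_2=c_2(n,D,H,\theta)$, such that the following holds for every integral domain $R$, every height function $h$ of $\theta$-type on $R$ and every $s$. Let $K^{alg}$ be an algebraic closure of the field of fractions of $R$, and let $f_1,\dots,f_s\in R[X_1,\dots,X_n]$ have no common zero in $(K^{alg})^n$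 and satisfy $\deg f_i\le D$ and $h(f_i)\le H$ for all $i$. Then there are a nonzero $a\in R$ and $h_1,\dots,h_s\in R[X_1,\dots,X_n]$ such that (i) $a=f_1h_1+\dots+f_sh_s$; (ii) $\deg h_i\le c_1$ for all $i$; (iii) $h(a)\le c_2$ and $h(h_i)\le c_2$ for all $i$; (iv) if $R$ is a UFD with the p-property and $h=|\cdot|$ is its absolute value, then moreover $a$ and the $h_i$ can be chosen, with (i)–(iii) and the same $c_1,c_2$, so that the greatest common divisor of $a$ and all coefficients of $h_1,\dots,h_s$ is $1$. -/

import Mathlib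

open scoped NNReal

universe u

/-- `h : R → [0, ∞)` is a height function of `θ`-type: for every natural number `m`, sums,
products and negatives of elements of height at most `m` have height at most `θ m`. -/
structure IsHeightOfType {R : Type*} [CommRing R] (θ : ℕ → ℕ) (h : R → ℝ≥0) : Prop where
  add_le : ∀ (m : ℕ) (x y : R), h x ≤ m → h y ≤ m → h (x + y) ≤ θ m
  mul_le : ∀ (m : ℕ) (x y : R), h x ≤ m → h y ≤ m → h (x * y) ≤ θ m
  neg_le : ∀ (m : ℕ) (x : R), h x ≤ m → h (-x) ≤ θ m

/-- The extension of `h` to polynomials: the maximum of the heights of the coefficients.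
A polynomial has only finitely many distinct coefficients, so the supremum is a maximum. -/
noncomputable def polyHeight {R : Type*} [CommRing R] {n : ℕ} (h : R → ℝ≥0)
    (f : MvPolynomial (Fin n) R) : ℝ≥0 :=
  ⨆ α : Fin n →₀ ℕ, h (f.coeff α)

/-- The supremum defining `polyHeight` is taken over a bounded set. -/
theorem bddAbove_range_height_coeff {R : Type*} [CommRing R] {n : ℕ} (h : R → ℝ≥0)
    (f : MvPolynomial (Fin n) R) :
    BddAbove (Set.range fun α : Fin n →₀ ℕ => h (f.coeff α)) := by
  classical
  refine ⟨max (h 0) (f.support.sup fun α => h (f.coeff α)), ?_⟩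
  rintro _ ⟨α, rfl⟩
  by_cases hα : α ∈ f.support
  · exact le_max_of_le_right (Finset.le_sup (f := fun α => h (f.coeff α)) hα)
  · have h0 : f.coeff α = 0 := by simpa using hα
    simp [h0]

/-- `R`, with the absolute value `v`, is a UFD with the p-property. -/
structure IsUFDWithPProperty {R : Type*} [CommRing R] [IsDomain R]
    (v : AbsoluteValue R ℝ) : Prop where
  ufd : UniqueFactorizationMonoid R
  abs_unit : ∀ u : R, IsUnit u → v u = 1
  exists_prime : ∀ p q : R, Prime p → Prime q → v p < 1 → 1 < v q →
    ∃ r : R, Prime r ∧ ¬ Associated r p ∧ v r < 1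

/-- The polynomials `f i` have no common zero with coordinates in an algebraic closure of the
field of fractions of `R`. -/
def NoCommonZero {R : Type*} [CommRing R] [IsDomain R] {n s : ℕ}
    (f : Fin s → MvPolynomial (Fin n) R) : Prop :=
  ¬ ∃ x : Fin n → AlgebraicClosure (FractionRing R), ∀ i, MvPolynomial.aeval x (f i) = 0

/-! Degrees are bounded by compactness. If no bound served all algebraically closed fields, a
counterexample for each `c` could be chosen and the product of the fields formed. Over this
zero-dimensional ring a Nullstellensatz still holds and yields one identity for 1, whose multipliers
have a finite degree valid in every factor (`exists_forall_one_mem_certificates`,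
`exists_degree_bound`).

Once degrees are bounded, a certificate is a linear system whose number of equations depends only on
`n` and `D`. `Matrix.exists_cramer_of_mem_span` extracts a nonsingular square system of that size,
whatever `s` is. Cramer's rule then uses a bounded number of ring operations on coefficients of the
`f i`, and iterating `θ` bounds the heights.

For (iv), dividing by the gcd may increase absolute values. The cure is to multiply by a power of a
small prime `p` and add a syzygy of the `f i`, multiplied by a power of a small prime `r` and
shifted to higher degree. The shift keeps the two sets of coefficients apart, so a common prime
divisor would be associated to both `p` and `r`. -/

/-! ### Uniform degree bounds from products of fields -/

section DegreeBound

variable {ι : Type*} {K : ι → Type*} [∀ i, Field (K i)]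

/-- A product of fields is zero-dimensional. -/
theorem Ideal.IsPrime.isMaximal_pi_field {Q : Ideal (∀ i, K i)} (hQ : Q.IsPrime) :
    Q.IsMaximal := by
  rw [Ideal.isMaximal_iff]
  refine ⟨(Ideal.ne_top_iff_one Q).1 hQ.ne_top, fun J x hJ hx hxJ => ?_⟩
  -- The product is von Neumann regular: since `0⁻¹ = 0`, the pointwise inverse is a quasi-inverse
  -- of `x`.
  have h0 : x * (1 - x * fun i => (x i)⁻¹) = 0 := by
    funext i
    by_cases hi : x i = 0 <;> simp [hi]
  have h1 : (1 - x * fun i => (x i)⁻¹) ∈ Q :=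
    (hQ.mem_or_mem (h0 ▸ Q.zero_mem : x * _ ∈ Q)).resolve_left hx
  have h2 := J.add_mem (hJ h1) (J.mul_mem_right (fun i => (x i)⁻¹) hxJ)
  simpa using h2

theorem isJacobsonRing_pi_field : IsJacobsonRing (∀ i, K i) :=
  isJacobsonRing_iff_prime_eq.2 fun Q hQ =>
    have := hQ.isMaximal_pi_field
    Ideal.jacobson_eq_self_of_isMaximal

/-- A monic polynomial of positive degree over a product of algebraically closed fields has a
root. -/
theorem Polynomial.Monic.exists_isRoot_pi [∀ i, IsAlgClosed (K i)]
    {p : Polynomial (∀ i, K i)} (hp : p.Monic) (hd : p.natDegree ≠ 0) : ∃ a, p.IsRoot a := by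
  have h : ∀ i, ∃ a, (p.map (Pi.evalRingHom K i)).IsRoot a := fun i => by
    apply IsAlgClosed.exists_root
    have := hp.natDegree_map (Pi.evalRingHom K i)
    intro h0
    rw [Polynomial.natDegree_eq_of_degree_eq_some h0] at this
    exact hd this.symm
  choose a ha using h
  refine ⟨a, ?_⟩
  funext i
  have := ha i
  rw [Polynomial.IsRoot, Polynomial.eval_map] at this
  have h2 := Polynomial.hom_eval₂ p (RingHom.id _) (Pi.evalRingHom K i) a
  simpa [Polynomial.eval₂_id] using h2.trans this

/-- A product of algebraically closed fields surjects onto every integral domain-valued integral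
extension. -/
theorem surjective_of_isIntegral_pi [∀ i, IsAlgClosed (K i)] {L : Type*} [CommRing L] [IsDomain L]
    (φ : (∀ i, K i) →+* L) (hφ : φ.IsIntegral) : Function.Surjective φ := by
  intro ξ
  obtain ⟨p, hp, hξ⟩ := hφ ξ
  generalize hN : p.natDegree = N
  induction N generalizing p with
  | zero =>
    rw [hp.natDegree_eq_zero.1 hN] at hξ
    simp at hξ
  | succ N ih =>
    have := φ.domain_nontrivial
    obtain ⟨a, ha⟩ := hp.exists_isRoot_pi (by omega)
    have hq := Polynomial.mul_divByMonic_eq_iff_isRoot.2 ha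
    set q := p /ₘ (Polynomial.X - Polynomial.C a)
    have hqm : q.Monic := (Polynomial.monic_X_sub_C a).of_mul_monic_left (hq ▸ hp)
    have hdeg := (Polynomial.monic_X_sub_C a).natDegree_mul hqm
    rw [hq, hN, Polynomial.natDegree_X_sub_C] at hdeg
    rw [← hq, Polynomial.eval₂_mul] at hξ
    rcases mul_eq_zero.1 hξ with h | h
    · refine ⟨a, ?_⟩
      rw [Polynomial.eval₂_sub, Polynomial.eval₂_X, Polynomial.eval₂_C, sub_eq_zero] at h
      exact h.symm
    · exact ih q hqm h (by omega)

/-- Polynomials of bounded degree over the factors assemble to one over the product. -/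
theorem MvPolynomial.exists_map_evalRingHom_eq {n D : ℕ} (f : ∀ i, MvPolynomial (Fin n) (K i))
    (hf : ∀ i, (f i).totalDegree ≤ D) :
    ∃ F : MvPolynomial (Fin n) (∀ i, K i), ∀ i, F.map (Pi.evalRingHom K i) = f i := by
  classical
  -- The degree bound matters here: one finite set of exponents must serve all `i`.
  let T : Finset (Fin n →₀ ℕ) := Finset.Icc 0 (Finsupp.equivFunOnFinite.symm fun _ => D)
  refine ⟨∑ α ∈ T, monomial α fun i => (f i).coeff α, fun i => ?_⟩
  ext β
  simp only [map_sum, map_monomial, coeff_sum, coeff_monomial, Finset.sum_ite_eq',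
    Pi.evalRingHom_apply]
  split_ifs with h
  · rfl
  · by_contra hne
    apply h
    simp only [T, Finset.mem_Icc, zero_le, true_and]
    intro j
    have h1 := (le_totalDegree (mem_support_iff.2 (Ne.symm hne))).trans (hf i)
    exact (Finsupp.le_degree j β).trans h1

/-- Nullstellensatz certificates of multiplier degree at most `c`. -/
noncomputable def MvPolynomial.certificates {n : ℕ} {k : Type*} [Field k] (S : Set (MvPolynomial (Fin n) k))
    (c : ℕ) : Submodule k (MvPolynomial (Fin n) k) :=
  Submodule.span k {p | ∃ f ∈ S, ∃ g : MvPolynomial (Fin n) k, g.totalDegree ≤ c ∧ p = f * g}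

theorem MvPolynomial.certificates_mono {n : ℕ} {k : Type*} [Field k]
    (S : Set (MvPolynomial (Fin n) k)) {c d : ℕ} (h : c ≤ d) :
    certificates S c ≤ certificates S d :=
  Submodule.span_mono fun _ ⟨f, hf, g, hg, hp⟩ => ⟨f, hf, g, hg.trans h, hp⟩

/-- If the ideal `I` over the product is the whole ring, one expression of 1 specialises to every
factor with the same degrees. Otherwise a maximal ideal above `I` yields a point in each `K i ^ n`;
polynomials of `S i` not vanishing there assemble to an element of `I` whose value at the point is a
unit. -/
theorem MvPolynomial.exists_forall_one_mem_certificates [∀ i, IsAlgClosed (K i)] {n D : ℕ}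
    (S : ∀ i, Set (MvPolynomial (Fin n) (K i))) (hD : ∀ i, ∀ f ∈ S i, f.totalDegree ≤ D)
    (hS : ∀ i, ∀ x : Fin n → K i, ∃ f ∈ S i, eval x f ≠ 0) :
    ∃ c, ∀ i, 1 ∈ certificates (S i) c := by
  let I : Ideal (MvPolynomial (Fin n) (∀ i, K i)) :=
    Ideal.span {F | ∀ i, F.map (Pi.evalRingHom K i) ∈ S i}
  by_cases hI : I = ⊤
  · have key : ∀ q ∈ I, ∃ c, ∀ i, q.map (Pi.evalRingHom K i) ∈ certificates (S i) c := by
      intro q hq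
      induction hq using Submodule.closure_induction with
      | zero => exact ⟨0, fun i => by simp⟩
      | add x y _ _ hx hy =>
        obtain ⟨c, hc⟩ := hx
        obtain ⟨d, hd⟩ := hy
        refine ⟨max c d, fun i => ?_⟩
        rw [map_add]
        exact add_mem (certificates_mono _ (le_max_left c d) (hc i))
          (certificates_mono _ (le_max_right c d) (hd i))
      | smul_mem G F hF =>
        refine ⟨G.totalDegree, fun i => Submodule.subset_span ⟨_, hF i,
          G.map (Pi.evalRingHom K i), ?_, ?_⟩⟩
        · exact Finset.sup_mono (support_map_subset _ _)
        · rw [smul_eq_mul, map_mul, mul_comm]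
    obtain ⟨c, hc⟩ := key 1 (hI ▸ Submodule.mem_top)
    exact ⟨c, fun i => by simpa using hc i⟩
  · exfalso
    obtain ⟨M, hM, hIM⟩ := Ideal.exists_le_maximal I hI
    let _ := Ideal.Quotient.field M
    have := isJacobsonRing_pi_field (K := K)
    -- Zariski's lemma over a Jacobson ring: the residue field is integral over the product, hence a
    -- quotient of it, so each variable is congruent to a constant modulo `M`.
    have hint := comp_C_integral_of_surjective_of_isJacobsonRing (Ideal.Quotient.mk M)
      Ideal.Quotient.mk_surjective
    have hsurj := surjective_of_isIntegral_pi _ hint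
    choose x hx using fun j => hsurj (Ideal.Quotient.mk M (X j))
    choose f hfS hf using fun i => hS i fun j => x j i
    obtain ⟨F, hF⟩ := exists_map_evalRingHom_eq f fun i => hD i _ (hfS i)
    have hFM : Ideal.Quotient.mk M F = 0 :=
      Ideal.Quotient.eq_zero_iff_mem.2 (hIM (Ideal.subset_span fun i => by rw [hF]; exact hfS i))
    have hev : (Ideal.Quotient.mk M).comp C (eval x F) = Ideal.Quotient.mk M F := by
      have : ((Ideal.Quotient.mk M).comp C).comp (eval x) = Ideal.Quotient.mk M := by
        apply MvPolynomial.ringHom_ext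
        · intro r; simp
        · intro j; simpa using hx j
      exact RingHom.congr_fun this F
    have hunit : IsUnit (eval x F) := by
      rw [Pi.isUnit_iff]
      intro i
      rw [isUnit_iff_ne_zero]
      have : (eval x F) i = eval (fun j => x j i) (f i) := by
        rw [← hF i, eval_map]
        exact eval₂_comp_left (Pi.evalRingHom K i) (RingHom.id _) x F
      rw [this]
      exact hf i
    have := hunit.map ((Ideal.Quotient.mk M).comp C)
    rw [hev, hFM] at this
    exact not_isUnit_zero this

end DegreeBound

/-- A degree bound for the Nullstellensatz, uniform over algebraically closed fields. -/
theorem MvPolynomial.exists_degree_bound (n D : ℕ) :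
    ∃ c, ∀ (k : Type u) [Field k] [IsAlgClosed k] (S : Set (MvPolynomial (Fin n) k)),
      (∀ f ∈ S, f.totalDegree ≤ D) → (∀ x : Fin n → k, ∃ f ∈ S, eval x f ≠ 0) →
      1 ∈ certificates S c := by
  by_contra! H
  -- The fields are indexed by the degree bound `c` that they violate.
  choose K instF instA S hD hS hc using H
  obtain ⟨c, h⟩ := exists_forall_one_mem_certificates S hD hS
  exact hc c (h c)

/-! ### Heights of sums, products and determinants -/

section Height

/-- The height bound after `k` ring operations on elements of height at most `m`. -/
def heightBound (θ : ℕ → ℕ) (m k : ℕ) : ℕ := (fun b => max b (θ b))^[k] m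

theorem heightBound_mono (θ : ℕ → ℕ) (m : ℕ) : Monotone (heightBound θ m) := by
  refine monotone_nat_of_le_succ fun k => ?_
  rw [heightBound, heightBound, Function.iterate_succ_apply']
  exact le_max_left _ _

theorem theta_heightBound_le (θ : ℕ → ℕ) (m k : ℕ) :
    θ (heightBound θ m k) ≤ heightBound θ m (k + 1) := by
  conv_rhs => rw [heightBound, Function.iterate_succ_apply']
  exact le_max_right _ _

namespace IsHeightOfType

theorem le_heightBound_mono {R : Type*} {h : R → ℝ≥0} {θ : ℕ → ℕ} {m k l : ℕ} (hkl : k ≤ l) {x : R} (hx : h x ≤ heightBound θ m k) :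
    h x ≤ heightBound θ m l :=
  hx.trans (by exact_mod_cast heightBound_mono θ m hkl)

variable {R : Type*} [CommRing R] {θ : ℕ → ℕ} {h : R → ℝ≥0} {m : ℕ}

theorem add_le_heightBound (hh : IsHeightOfType θ h) {k : ℕ} {x y : R}
    (hx : h x ≤ heightBound θ m k) (hy : h y ≤ heightBound θ m k) :
    h (x + y) ≤ heightBound θ m (k + 1) :=
  (hh.add_le _ x y hx hy).trans (by exact_mod_cast theta_heightBound_le θ m k)

theorem mul_le_heightBound (hh : IsHeightOfType θ h) {k : ℕ} {x y : R}
    (hx : h x ≤ heightBound θ m k) (hy : h y ≤ heightBound θ m k) :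
    h (x * y) ≤ heightBound θ m (k + 1) :=
  (hh.mul_le _ x y hx hy).trans (by exact_mod_cast theta_heightBound_le θ m k)

theorem neg_le_heightBound (hh : IsHeightOfType θ h) {k : ℕ} {x : R}
    (hx : h x ≤ heightBound θ m k) : h (-x) ≤ heightBound θ m (k + 1) :=
  (hh.neg_le _ x hx).trans (by exact_mod_cast theta_heightBound_le θ m k)

theorem sum_le_heightBound (hh : IsHeightOfType θ h) {k : ℕ} (h0 : h 0 ≤ heightBound θ m k)
    {κ : Type*} (s : Finset κ) (x : κ → R) (hx : ∀ i ∈ s, h (x i) ≤ heightBound θ m k) :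
    h (∑ i ∈ s, x i) ≤ heightBound θ m (k + s.card) := by
  induction s using Finset.cons_induction with
  | empty => simpa using h0
  | cons a s ha ih =>
    rw [Finset.sum_cons, Finset.card_cons, ← add_assoc]
    exact hh.add_le_heightBound
      (le_heightBound_mono (Nat.le_add_right _ _) (hx a (Finset.mem_cons_self a s)))
      (ih fun i hi => hx i (Finset.mem_cons_of_mem hi))

theorem prod_le_heightBound (hh : IsHeightOfType θ h) {k : ℕ}
    {κ : Type*} (s : Finset κ) (hs : s.Nonempty) (x : κ → R)
    (hx : ∀ i ∈ s, h (x i) ≤ heightBound θ m k) :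
    h (∏ i ∈ s, x i) ≤ heightBound θ m (k + s.card) := by
  induction hs using Finset.Nonempty.cons_induction with
  | singleton a =>
    rw [Finset.prod_singleton]
    exact le_heightBound_mono (Nat.le_add_right _ _) (hx a (Finset.mem_singleton_self a))
  | cons a s ha _ ih =>
    rw [Finset.prod_cons, Finset.card_cons, ← add_assoc]
    exact hh.mul_le_heightBound
      (le_heightBound_mono (Nat.le_add_right _ _) (hx a (Finset.mem_cons_self a s)))
      (ih fun i hi => hx i (Finset.mem_cons_of_mem hi))

/-- The operations counted are the product over `ι`, one sign, and the sum over permutations.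
Nonemptiness of `ι` avoids the empty product, as nothing bounds `h 1`. -/
theorem det_le_heightBound (hh : IsHeightOfType θ h) (h0 : h 0 ≤ m) {ι : Type*} [Fintype ι]
    [DecidableEq ι] [Nonempty ι] (M : Matrix ι ι R) (hM : ∀ i j, h (M i j) ≤ m) :
    h M.det ≤ heightBound θ m
      (Fintype.card ι + 1 + (Finset.univ : Finset (Equiv.Perm ι)).card) := by
  rw [Matrix.det_apply]
  refine hh.sum_le_heightBound (le_heightBound_mono (Nat.zero_le _) h0) _ _ fun σ _ => ?_
  have hp : h (∏ i, M (σ i) i) ≤ heightBound θ m (Fintype.card ι) := by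
    have := hh.prod_le_heightBound (k := 0) Finset.univ Finset.univ_nonempty
      (fun i => M (σ i) i) fun i _ => hM _ _
    simpa using this
  rcases Int.units_eq_one_or (Equiv.Perm.sign σ) with hs | hs
  · rw [hs, one_smul]
    exact le_heightBound_mono (Nat.le_succ _) hp
  · rw [hs, Units.neg_smul, one_smul]
    exact hh.neg_le_heightBound hp

end IsHeightOfType

end Height

/-! ### Cramer's rule for a system with any number of columns -/

section Cramer

/-- If `e` lies in the `K`-span of the vectors `u j`, with entries in a subring `R`, a square
system with columns among the `u j` and the `c • eₗ` solves `M x = c det M e` over `R`, with the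
columns of the second kind unused. -/
theorem Matrix.exists_cramer_of_mem_span {R K : Type*} [CommRing R] [Field K] [Algebra R K]
    [FaithfulSMul R K] {ι J : Type*} [Fintype ι] [DecidableEq ι] (u : J → ι → R) {c : R}
    (hc : c ≠ 0) (e : ι)
    (he : (Pi.single e 1 : ι → K) ∈
      Submodule.span K (Set.range fun j l => algebraMap R K (u j l))) :
    ∃ M : Matrix ι ι R, M.det ≠ 0 ∧ ∀ k, (∃ j, ∀ l, M l k = u j l) ∨
      ((∃ i, ∀ l, M l k = (Pi.single i c : ι → R) l) ∧ M.cramer (Pi.single e c) k = 0) := by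
  have hinj := FaithfulSMul.algebraMap_injective R K
  have hcK : algebraMap R K c ≠ 0 := by simpa using hc
  set A : Set (ι → K) := Set.range fun j l => algebraMap R K (u j l)
  let B : Set (ι → K) := Set.range fun i l => algebraMap R K ((Pi.single i c : ι → R) l)
  -- A basis of the span of the `u j` is completed by vectors `c • eᵢ`. Using `c` in place of 1
  -- keeps 1, whose height is uncontrolled, out of the matrix.
  obtain ⟨b₀, hb₀A, hspan, hli₀⟩ := exists_linearIndependent K A
  obtain ⟨b, hbt, hb₀b, htb, hli⟩ := exists_linearIndepOn_id_extension (K := K) (s := b₀)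
    (t := b₀ ∪ B) hli₀ Set.subset_union_left
  have htop : ⊤ ≤ Submodule.span K (Set.range ((↑) : b → ι → K)) := by
    rw [Subtype.range_coe]
    intro v _
    rw [← Finset.univ_sum_single v]
    refine Submodule.sum_mem _ fun i _ => ?_
    have h1 : (fun l => algebraMap R K ((Pi.single i c : ι → R) l)) ∈ Submodule.span K b :=
      htb (Or.inr ⟨i, rfl⟩)
    have h2 : (Pi.single i (v i) : ι → K) = (v i / algebraMap R K c) •
        fun l => algebraMap R K ((Pi.single i c : ι → R) l) := by
      funext l
      by_cases hl : l = i
      · subst hl; simp [hcK]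
      · simp [hl]
    rw [h2]
    exact Submodule.smul_mem _ _ h1
  let β : Module.Basis b K (ι → K) := Module.Basis.mk hli htop
  let ε : b ≃ ι := β.indexEquiv (Pi.basisFun K ι)
  let γ := β.reindex ε
  have hγ : ∀ k, γ k = (ε.symm k : ι → K) := fun k => by simp [γ, β]
  have hcol : ∀ k, ∃ w : ι → R, (∀ l, γ k l = algebraMap R K (w l)) ∧
      ((γ k ∈ b₀ ∧ ∃ j, w = u j) ∨ (γ k ∉ b₀ ∧ ∃ i, w = Pi.single i c)) := by
    intro k
    by_cases hk : γ k ∈ b₀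
    · obtain ⟨j, hj⟩ := hb₀A hk
      exact ⟨u j, fun l => by rw [← hj], Or.inl ⟨hk, j, rfl⟩⟩
    · have : γ k ∈ b := by rw [hγ]; exact (ε.symm k).2
      obtain ⟨i, hi⟩ := (hbt this).resolve_left hk
      exact ⟨Pi.single i c, fun l => by rw [← hi], Or.inr ⟨hk, i, rfl⟩⟩
  choose w hw hwc using hcol
  let M : Matrix ι ι R := Matrix.of fun l k => w k l
  have hMcol : (M.map (algebraMap R K)).col = γ := by
    funext k l
    simp [M, hw, Matrix.col]
  have hunit : IsUnit (M.map (algebraMap R K)) := by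
    rw [← Matrix.linearIndependent_cols_iff_isUnit, hMcol]
    exact γ.linearIndependent
  have hmul : ∀ y : ι → K, (M.map (algebraMap R K)).mulVec y = ∑ k, y k • γ k := by
    intro y
    funext l
    simp [Matrix.mulVec, dotProduct, M, hw, mul_comm]
  refine ⟨M, ?_, fun k => ?_⟩
  · intro h0
    rw [Matrix.isUnit_iff_isUnit_det, ← RingHom.mapMatrix_apply, ← RingHom.map_det, h0] at hunit
    simp at hunit
  · rcases hwc k with ⟨hk, j, hj⟩ | ⟨hk, i, hi⟩
    · exact Or.inl ⟨j, fun l => by simp [M, hj]⟩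
    · refine Or.inr ⟨⟨i, fun l => by simp [M, hi]⟩, ?_⟩
      -- The target lies in the span of `b₀`, so its coordinates on the added columns vanish; the
      -- Cramer solution is a multiple of these coordinates.
      have hsupp : ↑(γ.repr (Pi.single e 1)).support ⊆ {k | γ k ∈ b₀} := by
        rw [← Module.Basis.mem_span_image]
        rw [← hspan] at he
        refine Submodule.span_mono (fun v hv => ?_) he
        refine ⟨ε ⟨v, hb₀b hv⟩, ?_, ?_⟩ <;> simp [hγ, hv]
      have hrk : γ.repr (Pi.single e 1) k = 0 := by
        by_contra hne
        exact hk (hsupp (Finsupp.mem_support_iff.2 hne))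
      have hx : (M.map (algebraMap R K)).mulVec
          (fun k => algebraMap R K (M.cramer (Pi.single e c) k)) =
          (algebraMap R K (M.det * c)) • (Pi.single e 1 : ι → K) := by
        funext l
        have := congrArg (algebraMap R K) (congrFun (M.mulVec_cramer (Pi.single e c)) l)
        rw [RingHom.map_mulVec] at this
        refine this.trans ?_
        by_cases hl : l = e
        · subst hl; simp
        · simp [hl]
      rw [hmul] at hx
      have h3 := congrArg (fun v => γ.repr v k) hx
      simp only [γ.repr_sum_self, map_smul, Finsupp.smul_apply, hrk, smul_zero] at h3
      exact hinj (h3.trans (map_zero _).symm)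

end Cramer

/-! ### Certificates of bounded degree and height -/

section Certificate

namespace MvPolynomial

/-- Extraction of the coefficients at a finite set of exponents. -/
noncomputable def coeffVec {n : ℕ} (k : Type*) [CommRing k] (T : Finset (Fin n →₀ ℕ)) :
    MvPolynomial (Fin n) k →ₗ[k] (T → k) :=
  LinearMap.pi fun l => lcoeff k l.1

theorem coeffVec_apply {n : ℕ} {k : Type*} [CommRing k] (T : Finset (Fin n →₀ ℕ))
    (p : MvPolynomial (Fin n) k) (l : T) : coeffVec k T p l = p.coeff l.1 := rfl

/-- Clearing denominators in the coefficient vector of a certificate. -/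
theorem coeffVec_one_mem_span {n s c : ℕ} {R K : Type*} [CommRing R] [Field K] [Algebra R K]
    (f : Fin s → MvPolynomial (Fin n) R) (T : Finset (Fin n →₀ ℕ))
    (h1 : 1 ∈ certificates (Set.range fun i => (f i).map (algebraMap R K)) c) :
    coeffVec K T 1 ∈ Submodule.span K (Set.range
      fun (j : {p : Fin s × (Fin n →₀ ℕ) // p.2.degree ≤ c}) (l : T) =>
        algebraMap R K (coeff l.1 (monomial j.1.2 1 * f j.1.1))) := by
  have h2 := Submodule.mem_map_of_mem (f := coeffVec K T) h1
  rw [certificates, Submodule.map_span] at h2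
  refine Submodule.span_le.2 ?_ h2
  rintro _ ⟨_, ⟨_, ⟨i, rfl⟩, g, hg, rfl⟩, rfl⟩
  have hsum : (f i).map (algebraMap R K) * g =
      ∑ β ∈ g.support, coeff β g • (monomial β 1 * (f i).map (algebraMap R K)) := by
    conv_lhs => rw [g.as_sum, Finset.mul_sum]
    refine Finset.sum_congr rfl fun β _ => ?_
    rw [← smul_mul_assoc, smul_monomial, smul_eq_mul, mul_one, mul_comm]
  simp only [SetLike.mem_coe]
  rw [hsum, map_sum]
  refine Submodule.sum_mem _ fun β hβ => ?_
  rw [map_smul]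
  refine Submodule.smul_mem _ _ (Submodule.subset_span ⟨⟨(i, β), ?_⟩, ?_⟩)
  · exact (le_totalDegree hβ).trans hg
  · funext l
    change algebraMap R K (coeff l.1 (monomial β 1 * f i)) = _
    rw [coeffVec_apply, ← coeff_map, map_mul, map_monomial, map_one]

end MvPolynomial

open MvPolynomial

theorem NoCommonZero.exists_coeff_ne_zero {R : Type*} [CommRing R] [IsDomain R] {n s : ℕ}
    {f : Fin s → MvPolynomial (Fin n) R} (hf : NoCommonZero f) : ∃ i α, coeff α (f i) ≠ 0 := by
  by_contra! H
  refine hf ⟨0, fun i => ?_⟩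
  have : f i = 0 := MvPolynomial.ext _ _ fun α => by simpa using H i α
  simp [this]

/-- Nullstellensatz certificates with bounds on degrees and heights, for arbitrary heights. -/
theorem exists_bounded_certificate (n D : ℕ) : ∃ c L : ℕ, ∀ (R : Type u) [CommRing R] [IsDomain R]
    (θ : ℕ → ℕ) (h : R → ℝ≥0) (_ : IsHeightOfType θ h) (m s : ℕ)
    (f : Fin s → MvPolynomial (Fin n) R), NoCommonZero f → (∀ i, (f i).totalDegree ≤ D) →
    h 0 ≤ m → (∀ i α, h ((f i).coeff α) ≤ m) →
    ∃ (a : R) (g : Fin s → MvPolynomial (Fin n) R), a ≠ 0 ∧ C a = ∑ i, f i * g i ∧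
      (∀ i, (g i).totalDegree ≤ c) ∧ h a ≤ heightBound θ m L ∧
      ∀ i α, h ((g i).coeff α) ≤ heightBound θ m L := by
  classical
  obtain ⟨c, hc⟩ := exists_degree_bound.{u} n D
  -- `T` indexes the equations and contains every exponent of a product of degree at most `c + D`.
  -- It is independent of `s`, hence so is `L₀`.
  let T : Finset (Fin n →₀ ℕ) := Finset.Icc 0 (Finsupp.equivFunOnFinite.symm fun _ => c + D)
  have hT : ∀ l : Fin n →₀ ℕ, l.degree ≤ c + D → l ∈ T := fun l hl =>
    Finset.mem_Icc.2 ⟨zero_le, fun j => (Finsupp.le_degree j l).trans hl⟩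
  let L₀ := Fintype.card T + 1 + (Finset.univ : Finset (Equiv.Perm T)).card
  refine ⟨c, L₀ + (Fintype.card T + 1), fun R _ _ θ h hh m s f hf hD h0m hm => ?_⟩
  obtain ⟨i₀, α₀, hα₀⟩ := hf.exists_coeff_ne_zero
  let K := AlgebraicClosure (FractionRing R)
  let e : T := ⟨0, hT 0 (by simp)⟩
  have : Nonempty T := ⟨e⟩
  have h1 := hc K (Set.range fun i => (f i).map (algebraMap R K))
    (by rintro _ ⟨i, rfl⟩
        exact (Finset.sup_mono (support_map_subset _ _)).trans (hD i))
    (fun x => by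
      by_contra! H
      refine hf ⟨x, fun i => ?_⟩
      have := H _ ⟨i, rfl⟩
      rwa [eval_map, ← aeval_def] at this)
  have h2 := coeffVec_one_mem_span f T h1
  have he : coeffVec K T 1 = Pi.single e 1 := by
    funext l
    rw [coeffVec_apply, coeff_one, Pi.single_apply]
    simp [e, Subtype.ext_iff, eq_comm]
  rw [he] at h2
  have hinj : FaithfulSMul R K := by
    rw [faithfulSMul_iff_algebraMap_injective, IsScalarTower.algebraMap_eq R (FractionRing R) K]
    exact (algebraMap (FractionRing R) K).injective.comp (IsFractionRing.injective R _)
  obtain ⟨M, hM, hcol⟩ := Matrix.exists_cramer_of_mem_span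
    (fun (j : {p : Fin s × (Fin n →₀ ℕ) // p.2.degree ≤ c}) (l : T) =>
        coeff l.1 (monomial j.1.2 1 * f j.1.1)) hα₀ e h2
  set b := coeff α₀ (f i₀)
  set x := M.cramer (Pi.single e b) with hx
  have hidx : ∀ k, ∃ j : {p : Fin s × (Fin n →₀ ℕ) // p.2.degree ≤ c}, ∀ l : T,
      M l k * x k = coeff l.1 (f j.1.1 * monomial j.1.2 (x k)) := by
    intro k
    rcases hcol k with ⟨j, hj⟩ | ⟨-, hk⟩
    · refine ⟨j, fun l => ?_⟩
      rw [hj l, mul_comm, ← coeff_C_mul, ← mul_assoc, C_mul_monomial, mul_one, mul_comm]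
    -- A dummy index: `x k = 0` for an added column.
    · refine ⟨⟨(i₀, 0), by simp⟩, fun l => ?_⟩
      simp [hk]
  choose j hj using hidx
  have hsingle : ∀ l : T, h ((Pi.single e b : T → R) l) ≤ m := fun l => by
    rw [Pi.single_apply]
    split_ifs
    exacts [hm _ _, h0m]
  have hMm : ∀ l k, h (M l k) ≤ m := by
    intro l k
    rcases hcol k with ⟨j, hj⟩ | ⟨⟨i, hi⟩, -⟩
    · rw [hj, coeff_monomial_mul']
      split_ifs
      · simpa using hm _ _
      · exact h0m
    · rw [hi, Pi.single_apply]
      split_ifs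
      exacts [hm _ _, h0m]
  have hxm : ∀ k, h (x k) ≤ heightBound θ m L₀ := by
    intro k
    rw [hx, Matrix.cramer_apply]
    refine hh.det_le_heightBound h0m _ fun l k' => ?_
    rw [Matrix.updateCol_apply]
    split_ifs
    exacts [hsingle l, hMm l k']
  have h0L : h 0 ≤ heightBound θ m L₀ := IsHeightOfType.le_heightBound_mono (Nat.zero_le _) h0m
  -- Each coefficient of a multiplier is a sum of at most `card T` Cramer numerators, padded with
  -- zeros.
  have hcoeff : ∀ i α, coeff α (∑ k, if (j k).1.1 = i then monomial (j k).1.2 (x k) else 0) =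
      ∑ k, if (j k).1.1 = i ∧ (j k).1.2 = α then x k else 0 := by
    intro i α
    rw [coeff_sum]
    refine Finset.sum_congr rfl fun k _ => ?_
    by_cases hk : (j k).1.1 = i <;> simp [hk]
  refine ⟨M.det * b, fun i => ∑ k, if (j k).1.1 = i then monomial (j k).1.2 (x k) else 0,
    mul_ne_zero hM hα₀, ?_, fun i => ?_, ?_, fun i α => ?_⟩
  · have hswap : (∑ i, f i * ∑ k, if (j k).1.1 = i then monomial (j k).1.2 (x k) else 0) =
        ∑ k, f (j k).1.1 * monomial (j k).1.2 (x k) := by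
      simp only [Finset.mul_sum, mul_ite, mul_zero]
      rw [Finset.sum_comm]
      simp
    rw [hswap]
    ext l
    rw [coeff_sum, coeff_C]
    by_cases hl : l ∈ T
    · have h3 := congrFun (M.mulVec_cramer (Pi.single e b)) ⟨l, hl⟩
      rw [← hx, Matrix.mulVec, dotProduct, Finset.sum_congr rfl fun k _ => hj k ⟨l, hl⟩] at h3
      rw [h3, Pi.smul_apply, Pi.single_apply]
      simp [e, eq_comm]
    · have hl0 : 0 ≠ l := by
        rintro rfl
        exact hl e.2
      rw [if_neg hl0]
      refine (Finset.sum_eq_zero fun k _ => ?_).symm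
      by_contra hne
      refine hl (hT l ((le_totalDegree (mem_support_iff.2 hne)).trans
        ((totalDegree_mul _ _).trans ?_)))
      rw [add_comm]
      exact add_le_add ((totalDegree_monomial_le _ _).trans (j k).2) (hD _)
  · refine totalDegree_finsetSum_le fun k _ => ?_
    split_ifs
    · exact (totalDegree_monomial_le _ _).trans (j k).2
    · simp
  · refine IsHeightOfType.le_heightBound_mono (k := L₀ + 1) (by omega)
      (hh.mul_le_heightBound (hh.det_le_heightBound h0m _ hMm)
        (IsHeightOfType.le_heightBound_mono (Nat.zero_le _) (hm _ _)))
  · rw [hcoeff]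
    refine IsHeightOfType.le_heightBound_mono (k := L₀ + (Finset.univ : Finset T).card)
      (by rw [Finset.card_univ]; omega) (hh.sum_le_heightBound h0L _ _ fun k _ => ?_)
    split_ifs
    exacts [hxm k, h0L]

end Certificate

/-! ### Primitive families of polynomials -/

section Primitive

open MvPolynomial

/-- A family of polynomials whose coefficients have only units as common divisors. -/
def IsPrimitiveFamily {R : Type*} [CommRing R] {n : ℕ} {κ : Type*} (g : κ → MvPolynomial (Fin n) R) : Prop :=
  ∀ d : R, (∀ k, C d ∣ g k) → IsUnit d

variable {R : Type*} [CommRing R] [IsDomain R] {n : ℕ}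

/-- Division of a family of polynomials by the greatest common divisor of its coefficients. -/
theorem exists_primitive_part [WfDvdMonoid R] {κ : Type*} (g : κ → MvPolynomial (Fin n) R)
    {k : κ} (hk : g k ≠ 0) :
    ∃ (d : R) (g' : κ → MvPolynomial (Fin n) R), d ≠ 0 ∧ (∀ k, g k = C d * g' k) ∧
      IsPrimitiveFamily g' := by
  obtain ⟨α, hα⟩ := MvPolynomial.ne_zero_iff.1 hk
  obtain ⟨x, hx⟩ : ∃ x, x = coeff α (g k) := ⟨_, rfl⟩
  -- Extracting a nonunit common divisor strictly lowers one fixed nonzero coefficient in the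
  -- divisibility order, so extraction terminates.
  induction x using WellFounded.induction (wellFounded_dvdNotUnit (α := R))
    generalizing g with
  | _ x ih =>
    by_cases hg : IsPrimitiveFamily g
    · exact ⟨1, g, one_ne_zero, fun k => by simp, hg⟩
    · simp only [IsPrimitiveFamily, not_forall] at hg
      obtain ⟨e, he, hu⟩ := hg
      choose g₁ hg₁ using he
      have hco : coeff α (g k) = e * coeff α (g₁ k) := by rw [hg₁ k, coeff_C_mul]
      have h1 : coeff α (g₁ k) ≠ 0 := fun h0 => hα (by rw [hco, h0, mul_zero])
      obtain ⟨d, g', hd, hg', hp⟩ := ih (coeff α (g₁ k))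
        ⟨h1, e, hu, by rw [hx, hco, mul_comm]⟩ g₁ (fun h0 => h1 (by rw [h0, coeff_zero])) h1 rfl
      have he0 : e ≠ 0 := fun h0 => hα (by rw [hco, h0, zero_mul])
      exact ⟨e * d, g', mul_ne_zero he0 hd, fun k => by rw [hg₁, hg', C_mul, mul_assoc], hp⟩

theorem totalDegree_C_mul_of_ne_zero {d : R} (hd : d ≠ 0) (q : MvPolynomial (Fin n) R) :
    (C d * q).totalDegree = q.totalDegree := by
  by_cases hq : q = 0
  · simp [hq]
  · rw [totalDegree_mul_of_isDomain (by simpa using hd) hq, totalDegree_C, zero_add]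

/-- A prime dividing all coefficients of a multiple of a primitive family divides the factor. -/
theorem IsPrimitiveFamily.prime_dvd {R : Type*} [CommRing R] {n : ℕ} {κ : Type*} {g : κ → MvPolynomial (Fin n) R}
    (hg : IsPrimitiveFamily g) {l p : R} (hl : Prime l) (h : ∀ k α, l ∣ p * coeff α (g k)) :
    l ∣ p := by
  by_contra hlp
  refine hl.not_isUnit (hg l fun k => (C_dvd_iff_dvd_coeff _ _).2 fun α => ?_)
  exact (hl.dvd_or_dvd (h k α)).resolve_left hlp

/-- Powers of an element of absolute value less than one make the coefficients of finitely many
polynomials small. -/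
theorem exists_pow_mul_coeff_le_one (v : AbsoluteValue R ℝ) {p : R} (hp : v p < 1)
    {κ : Type*} [Finite κ] (g : κ → MvPolynomial (Fin n) R) :
    ∃ k : ℕ, ∀ i α, v (p ^ k * coeff α (g i)) ≤ 1 := by
  have hb : ∀ i, ∃ B : ℝ, 0 < B ∧ ∀ α, v (coeff α (g i)) ≤ B := by
    intro i
    obtain ⟨B, hB⟩ := bddAbove_range_height_coeff (fun x => (⟨v x, v.nonneg x⟩ : ℝ≥0)) (g i)
    refine ⟨B + 1, by positivity, fun α => ?_⟩
    have : v (coeff α (g i)) ≤ (B : ℝ) := hB ⟨α, rfl⟩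
    linarith
  choose B hB0 hB using hb
  have hk : ∀ i, ∃ k : ℕ, v p ^ k < (B i)⁻¹ := fun i =>
    exists_pow_lt_of_lt_one (inv_pos.2 (hB0 i)) hp
  choose k hk using hk
  obtain ⟨N, hN⟩ := Set.finite_range k |>.bddAbove
  refine ⟨N, fun i α => ?_⟩
  rw [map_mul, map_pow]
  have h1 : v p ^ N ≤ (B i)⁻¹ :=
    (pow_le_pow_of_le_one (v.nonneg p) hp.le (hN ⟨i, rfl⟩)).trans (hk i).le
  calc v p ^ N * v (coeff α (g i)) ≤ (B i)⁻¹ * B i :=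
        mul_le_mul h1 (hB i α) (v.nonneg _) (inv_pos.2 (hB0 i)).le
    _ = 1 := inv_mul_cancel₀ (hB0 i).ne'

/-- A primitive combination of two primitive families with disjoint supports. -/
theorem IsPrimitiveFamily.isUnit_of_dvd [UniqueFactorizationMonoid R] {κ κ' : Type*}
    {g : κ → MvPolynomial (Fin n) R} {w : κ' → MvPolynomial (Fin n) R}
    (hg : IsPrimitiveFamily g) (hw : IsPrimitiveFamily w) {p r : R} (hp : Prime p) (hr : Prime r)
    (hpr : ¬ Associated r p) {k m : ℕ} {d : R} (hd : d ≠ 0)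
    (h₁ : ∀ i α, d ∣ p ^ k * coeff α (g i)) (h₂ : ∀ i α, d ∣ r ^ m * coeff α (w i)) :
    IsUnit d := by
  by_contra hu
  obtain ⟨l, hl, hld⟩ := WfDvdMonoid.exists_irreducible_factor hu hd
  have hl := hl.prime
  have h3 := hl.dvd_of_dvd_pow (hg.prime_dvd hl fun i α => hld.trans (h₁ i α))
  have h4 := hl.dvd_of_dvd_pow (hw.prime_dvd hl fun i α => hld.trans (h₂ i α))
  rw [hl.dvd_prime_iff_associated hp] at h3
  rw [hl.dvd_prime_iff_associated hr] at h4
  exact hpr (h4.symm.trans h3)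

end Primitive

/-! ### Primitive certificates under the p-property -/

section PProperty

open MvPolynomial

variable {R : Type*} [CommRing R] [IsDomain R]

theorem IsUFDWithPProperty.one_le_of_forall_prime {v : AbsoluteValue R ℝ}
    (hv : IsUFDWithPProperty v) (hp : ∀ p, Prime p → 1 ≤ v p) {d : R} (hd : d ≠ 0) : 1 ≤ v d := by
  have := hv.ufd
  induction d using UniqueFactorizationMonoid.induction_on_prime with
  | h₁ => exact absurd rfl hd
  | h₂ x hx => exact (hv.abs_unit x hx).ge
  | h₃ a p ha hpp ih =>
    rw [map_mul]
    exact one_le_mul_of_one_le_of_one_le (hp p hpp) (ih ha)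

theorem IsUFDWithPProperty.le_one_of_forall_prime {v : AbsoluteValue R ℝ}
    (hv : IsUFDWithPProperty v) (hp : ∀ p, Prime p → v p ≤ 1) (d : R) : v d ≤ 1 := by
  have := hv.ufd
  induction d using UniqueFactorizationMonoid.induction_on_prime with
  | h₁ => simp
  | h₂ x hx => exact (hv.abs_unit x hx).le
  | h₃ a p ha hpp ih =>
    rw [map_mul]
    exact mul_le_one₀ (hp p hpp) (v.nonneg _) ih

theorem sum_mul_ite_sub_ite {A ι : Type*} [CommRing A] [Fintype ι] [DecidableEq ι] (f : ι → A)
    {i j : ι} (hij : i ≠ j) (x y : A) :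
    ∑ l, f l * (if l = i then x else if l = j then -y else 0) = f i * x - f j * y := by
  have : ∀ l, f l * (if l = i then x else if l = j then -y else 0) =
      (if l = i then f i * x else 0) + if l = j then -(f j * y) else 0 := by
    intro l
    by_cases h1 : l = i
    · subst h1; simp [hij]
    · by_cases h2 : l = j
      · subst h2; simp [h1]
      · simp [h1, h2]
  simp_rw [this, Finset.sum_add_distrib]
  simp [sub_eq_add_neg]

/-- Under the p-property a certificate can be made primitive. -/
theorem IsUFDWithPProperty.exists_primitive_certificate {v : AbsoluteValue R ℝ}
    (hv : IsUFDWithPProperty v) {n s c D : ℕ} (hn : 1 ≤ n) {B : ℝ} (hB : 1 ≤ B)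
    {f : Fin s → MvPolynomial (Fin n) R} (hfD : ∀ i, (f i).totalDegree ≤ D)
    (hfB : ∀ i α, v ((f i).coeff α) ≤ B) {a : R} {g : Fin s → MvPolynomial (Fin n) R}
    (ha : a ≠ 0) (hsum : C a = ∑ i, f i * g i) (hgc : ∀ i, (g i).totalDegree ≤ c)
    (haB : v a ≤ B) (hgB : ∀ i α, v ((g i).coeff α) ≤ B) :
    ∃ (a : R) (g : Fin s → MvPolynomial (Fin n) R), a ≠ 0 ∧ C a = ∑ i, f i * g i ∧
      (∀ i, (g i).totalDegree ≤ c + 1 + D) ∧ v a ≤ B ∧ (∀ i α, v ((g i).coeff α) ≤ B) ∧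
      ∀ d : R, d ∣ a → (∀ i α, d ∣ (g i).coeff α) → IsUnit d := by
  classical
  have := hv.ufd
  -- The syzygy used below needs two nonzero `f i`. If only one is nonzero, comparing degrees shows
  -- that it is constant, and it serves as `a` with multiplier 1.
  by_cases hpair : ∃ i j, i ≠ j ∧ f i ≠ 0 ∧ f j ≠ 0
  swap
  · push Not at hpair
    obtain ⟨i, hi⟩ : ∃ i, f i ≠ 0 := by
      by_contra! H
      apply ha
      simpa [H] using hsum
    have hj : ∀ j, j ≠ i → f j = 0 := fun j hji => by
      by_contra h
      exact hi (hpair j i hji h)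
    rw [Finset.sum_eq_single_of_mem i (Finset.mem_univ i) fun j _ hji => by
      rw [hj j hji, zero_mul]] at hsum
    have hgi : g i ≠ 0 := fun h => ha (by simpa [h] using hsum)
    have hdeg := congrArg totalDegree hsum
    rw [totalDegree_C, totalDegree_mul_of_isDomain hi hgi] at hdeg
    have hfi := totalDegree_eq_zero_iff_eq_C.1 (show (f i).totalDegree = 0 by omega)
    refine ⟨coeff 0 (f i), Pi.single i 1, ?_, ?_, fun j => ?_, hfB i 0, fun j α => ?_,
      fun d _ hd => ?_⟩
    · intro h0
      rw [h0, C_0] at hfi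
      exact hi hfi
    · rw [Finset.sum_eq_single_of_mem i (Finset.mem_univ i) fun j _ hji => by
        rw [hj j hji, zero_mul], Pi.single_eq_same, mul_one]
      exact hfi.symm
    · by_cases hji : j = i
      · subst hji; simp
      · simp [hji]
    · by_cases hji : j = i
      · subst hji
        rw [Pi.single_eq_same, coeff_one]
        split_ifs
        · simpa using hB
        · simpa using zero_le_one.trans hB
      · simpa [hji] using zero_le_one.trans hB
    · simpa using isUnit_of_dvd_one (by simpa using hd i 0)
  obtain ⟨i₁, i₂, hne, hf₁, hf₂⟩ := hpair
  obtain ⟨d, G, hd, hG, hGp⟩ := exists_primitive_part (fun o : Option (Fin s) => o.elim (C a) g)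
    (k := none) (by simpa using ha)
  have hGn : G none = C (coeff 0 (G none)) := by
    ext α
    have h1 := congrArg (coeff α) (hG none)
    rw [Option.elim_none, coeff_C, coeff_C_mul] at h1
    rw [coeff_C]
    split_ifs at h1 ⊢ with h0
    · rw [h0]
    · exact (mul_eq_zero.1 h1.symm).resolve_left hd
  set a' := coeff 0 (G none) with ha'
  have haa' : a = d * a' := by
    have h1 := hG none
    rw [Option.elim_none, hGn, ← C_mul] at h1
    exact C_injective _ _ h1
  have ha'0 : a' ≠ 0 := fun h0 => ha (by rw [haa', h0, mul_zero])
  let g' : Fin s → MvPolynomial (Fin n) R := fun i => G (some i)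
  have hgg' : ∀ i, g i = C d * g' i := fun i => hG (some i)
  have hsum' : C a' = ∑ i, f i * g' i := by
    have hCd : (C d : MvPolynomial (Fin n) R) ≠ 0 := by simpa using hd
    apply mul_left_cancel₀ hCd
    rw [← C_mul, ← haa', hsum, Finset.mul_sum]
    refine Finset.sum_congr rfl fun i _ => ?_
    rw [hgg']
    ring
  have hg'c : ∀ i, (g' i).totalDegree ≤ c := fun i => by
    rw [← totalDegree_C_mul_of_ne_zero hd, ← hgg']
    exact hgc i
  have hprim : ∀ e : R, e ∣ a' → (∀ i α, e ∣ (g' i).coeff α) → IsUnit e := by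
    intro e he1 he2
    refine hGp e fun k => ?_
    cases k with
    | none => rw [hGn]; exact map_dvd C he1
    | some i => exact (C_dvd_iff_dvd_coeff _ _).2 (he2 i)
  -- Without small primes, dividing by `d` does not increase absolute values; without large primes,
  -- everything is at most 1. Only the mixed case needs the p-property.
  by_cases hlt : ∃ p, Prime p ∧ v p < 1
  swap
  · push Not at hlt
    have h1 := hv.one_le_of_forall_prime hlt hd
    have hle : ∀ x : R, v x ≤ v (d * x) := fun x => by
      rw [map_mul]
      exact le_mul_of_one_le_left (v.nonneg _) h1
    refine ⟨a', g', ha'0, hsum', fun i => (hg'c i).trans (by omega), ?_, fun i α => ?_, hprim⟩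
    · exact (hle a').trans (haa' ▸ haB)
    · refine (hle _).trans ?_
      rw [← coeff_C_mul, ← hgg']
      exact hgB i α
  by_cases hgt : ∃ q, Prime q ∧ 1 < v q
  swap
  · push Not at hgt
    have h1 := hv.le_one_of_forall_prime hgt
    exact ⟨a', g', ha'0, hsum', fun i => (hg'c i).trans (by omega), (h1 _).trans hB,
      fun i α => (h1 _).trans hB, hprim⟩
  obtain ⟨p, hp, hp1⟩ := hlt
  obtain ⟨q, hq, hq1⟩ := hgt
  obtain ⟨r, hr, hrp, hr1⟩ := hv.exists_prime p q hp hq hp1 hq1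
  obtain ⟨b, W, hb, hW, hWp⟩ := exists_primitive_part (fun o : Bool => if o then f i₁ else f i₂)
    (k := true) (by simpa using hf₁)
  have hW₁ : f i₁ = C b * W true := hW true
  have hW₂ : f i₂ = C b * W false := hW false
  -- No uniform bound on `k` or `m` is needed: these powers are constants, so degrees are
  -- unaffected, and all resulting absolute values are at most 1.
  obtain ⟨k, hk⟩ := exists_pow_mul_coeff_le_one v hp1 G
  obtain ⟨m, hm⟩ := exists_pow_mul_coeff_le_one v hr1 W
  let z : Fin n := ⟨0, hn⟩
  -- The exponent exceeds the degree `c` of every `g' l`, so each coefficient of `u` comes from just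
  -- one of its two summands.
  let E : Fin n →₀ ℕ := Finsupp.single z (c + 1)
  -- The Koszul syzygy of `f i₁` and `f i₂` with their common content `b` removed, so that its
  -- coefficients have no common prime factor.
  let w : Fin s → MvPolynomial (Fin n) R :=
    fun l => if l = i₁ then W false else if l = i₂ then -W true else 0
  have hw : ∀ l, w l = 0 ∨ ∃ o, w l = W o ∨ w l = -W o := by
    intro l
    simp only [w]
    split_ifs
    exacts [Or.inr ⟨false, Or.inl rfl⟩, Or.inr ⟨true, Or.inr rfl⟩, Or.inl rfl]
  have hwsum : ∑ l, f l * w l = 0 := by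
    rw [sum_mul_ite_sub_ite f hne, hW₁, hW₂]
    ring
  have hWD : ∀ o, (W o).totalDegree ≤ D := by
    intro o
    rw [← totalDegree_C_mul_of_ne_zero hb]
    cases o
    · exact hW₂ ▸ hfD i₂
    · exact hW₁ ▸ hfD i₁
  have hwD : ∀ l, (w l).totalDegree ≤ D := by
    intro l
    rcases hw l with h | ⟨o, h | h⟩ <;> rw [h]
    · simp
    · exact hWD o
    · exact (totalDegree_neg _).trans_le (hWD o)
  have hwm : ∀ l α, v (r ^ m * coeff α (w l)) ≤ 1 := by
    intro l α
    rcases hw l with h | ⟨o, h | h⟩ <;> rw [h]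
    · simp
    · exact hm o α
    · rw [coeff_neg, mul_neg, v.map_neg]
      exact hm o α
  let u : Fin s → MvPolynomial (Fin n) R := fun l => C (p ^ k) * g' l + monomial E (r ^ m) * w l
  have hlow : ∀ l α, ¬ E ≤ α → coeff α (u l) = p ^ k * coeff α (g' l) := by
    intro l α hα
    rw [coeff_add, coeff_C_mul, coeff_monomial_mul', if_neg hα, add_zero]
  have hg'0 : ∀ l α, E ≤ α → coeff α (g' l) = 0 := by
    intro l α hα
    by_contra h0
    have h1 : α z ≤ c := (Finsupp.le_degree z α).trans
      ((le_totalDegree (mem_support_iff.2 h0)).trans (hg'c l))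
    have h2 := hα z
    simp only [E, Finsupp.single_eq_same] at h2
    omega
  have hhigh : ∀ l α, E ≤ α → coeff α (u l) = r ^ m * coeff (α - E) (w l) := by
    intro l α hα
    rw [coeff_add, coeff_C_mul, coeff_monomial_mul', if_pos hα, hg'0 l α hα, mul_zero, zero_add]
  refine ⟨p ^ k * a', u, mul_ne_zero (pow_ne_zero _ hp.ne_zero) ha'0, ?_, fun l => ?_,
    (hk none 0).trans hB, fun l α => ?_, fun e he1 he2 => ?_⟩
  · simp only [u, mul_add, Finset.sum_add_distrib, mul_left_comm (f _), ← Finset.mul_sum]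
    rw [hwsum, mul_zero, add_zero, ← hsum', C_mul]
  · refine (totalDegree_add _ _).trans (max_le ?_ ?_)
    · rw [totalDegree_C_mul_of_ne_zero (pow_ne_zero _ hp.ne_zero)]
      exact (hg'c l).trans (by omega)
    · refine (totalDegree_mul _ _).trans (add_le_add ((totalDegree_monomial_le _ _).trans ?_)
        (hwD l))
      exact (Finsupp.degree_single z (c + 1)).le
  · by_cases hα : E ≤ α
    · rw [hhigh l α hα]
      exact (hwm l _).trans hB
    · rw [hlow l α hα]
      exact (hk (some l) α).trans hB
  · have hw_dvd : ∀ l α, e ∣ r ^ m * coeff α (w l) := by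
      intro l α
      have := he2 l (α + E)
      rwa [hhigh l _ le_add_self, add_tsub_cancel_right] at this
    refine hGp.isUnit_of_dvd hWp hp hr hrp (k := k) (m := m) ?_ (fun o α => ?_) fun o α => ?_
    · rintro rfl
      exact mul_ne_zero (pow_ne_zero _ hp.ne_zero) ha'0 (zero_dvd_iff.1 he1)
    · cases o with
      | none =>
        rw [hGn, coeff_C]
        split_ifs
        · exact he1
        · simp
      | some l =>
        by_cases hα : E ≤ α
        · rw [show coeff α (G (some l)) = 0 from hg'0 l α hα, mul_zero]
          exact dvd_zero e
        · have := he2 l α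
          rwa [hlow l α hα] at this
    · cases o
      · simpa [w] using hw_dvd i₁ α
      · simpa [w, hne.symm] using hw_dvd i₂ α

end PProperty

/-! ### The main theorem -/

theorem theoremA (n D : ℕ) (hn : 1 ≤ n) (hD : 1 ≤ D) :
    ∃ c₁ : ℕ, ∀ (H : ℝ≥0) (_ : 1 ≤ H) (θ : ℕ → ℕ), ∃ c₂ : ℝ≥0,
      ∀ (R : Type u) [CommRing R] [IsDomain R] (h : R → ℝ≥0), IsHeightOfType θ h →
      ∀ (s : ℕ) (f : Fin s → MvPolynomial (Fin n) R), NoCommonZero f →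
        (∀ i, (f i).totalDegree ≤ D) → (∀ i, polyHeight h (f i) ≤ H) →
        ∃ (a : R) (g : Fin s → MvPolynomial (Fin n) R), a ≠ 0 ∧
          MvPolynomial.C a = ∑ i, f i * g i ∧
          (∀ i, (g i).totalDegree ≤ c₁) ∧
          (h a ≤ c₂ ∧ ∀ i, polyHeight h (g i) ≤ c₂) ∧
          (∀ v : AbsoluteValue R ℝ, IsUFDWithPProperty v → (∀ x, (h x : ℝ) = v x) →
            ∀ d : R, d ∣ a → (∀ i α, d ∣ (g i).coeff α) → IsUnit d) := by
  obtain ⟨c, L, hcL⟩ := exists_bounded_certificate.{u} n D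
  -- `H` enters the maximum because the primitive certificate needs a bound that is at least 1 and
  -- dominates the coefficients of the `f i`.
  refine ⟨c + 1 + D, fun H hH θ => ⟨max H (heightBound θ ⌈H⌉₊ L), fun R _ _ h hh s f hf hfD hfH =>
    ?_⟩⟩
  have hcoeff : ∀ i α, h ((f i).coeff α) ≤ H := fun i α =>
    (le_ciSup (bddAbove_range_height_coeff h (f i)) α).trans (hfH i)
  -- The axioms do not bound `h 0`; but 0 is the coefficient of some `f i` at an exponent of degree
  -- `D + 1`, which exists as `n ≥ 1`.
  have h0 : h 0 ≤ H := by
    obtain ⟨i, -⟩ := hf.exists_coeff_ne_zero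
    have h1 := hcoeff i (Finsupp.single ⟨0, hn⟩ (D + 1))
    rwa [MvPolynomial.coeff_eq_zero_of_totalDegree_lt] at h1
    refine (hfD i).trans_lt ?_
    change D < Finsupp.degree _
    simp
  obtain ⟨a, g, ha, hsum, hgc, haB, hgB⟩ := hcL R θ h hh ⌈H⌉₊ s f hf hfD
    (h0.trans (Nat.le_ceil H)) fun i α => (hcoeff i α).trans (Nat.le_ceil H)
  -- `a` and `g` must be fixed before `v` is given, so the existence of a suitable `v` is decided
  -- first; primitivity itself does not involve `v`.
  by_cases hv : ∃ v : AbsoluteValue R ℝ, IsUFDWithPProperty v ∧ ∀ x, (h x : ℝ) = v x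
  · obtain ⟨v, hv, hhv⟩ := hv
    obtain ⟨a', g', ha', hsum', hgc', haB', hgB', hprim⟩ := hv.exists_primitive_certificate hn
      (B := (max H (heightBound θ ⌈H⌉₊ L) : ℝ≥0)) (by exact_mod_cast hH.trans (le_max_left _ _)) hfD
      (fun i α => by rw [← hhv]; exact_mod_cast (hcoeff i α).trans (le_max_left _ _))
      ha hsum hgc (by rw [← hhv]; exact_mod_cast haB.trans (le_max_right _ _))
      (fun i α => by rw [← hhv]; exact_mod_cast (hgB i α).trans (le_max_right _ _))
    refine ⟨a', g', ha', hsum', hgc', ⟨?_, fun i => ciSup_le fun α => ?_⟩, fun _ _ _ => hprim⟩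
    · rw [← hhv] at haB'
      exact_mod_cast haB'
    · have := hgB' i α
      rw [← hhv] at this
      exact_mod_cast this
  · exact ⟨a, g, ha, hsum, fun i => (hgc i).trans (by omega),
      ⟨haB.trans (le_max_right _ _), fun i => ciSup_le fun α => (hgB i α).trans (le_max_right _ _)⟩,
      fun v h1 h2 => absurd ⟨v, h1, h2⟩ hv⟩
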